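/- Let $(d_n)_{n\ge1}$ be a nondecreasing sequence of positive integers with $d_n\to\infty$, let $k\ge1$ be an integer and let $\sigma>0$. For each $n$ let $X_n$ and $\Xi_n$ be independent random vectors in $\mathbb{R}^{d_n}$, where $X_n$ is absolutely continuous with respect to Lebesgue measure, and put $Y_n=\Xi_n'X_n$. For $j\ge1$ let $\widetilde X_{n,1},\dots,\widetilde X_{n,j}$ be mutually independent copies of $X_n$ and let $A_{n,j}=(\widetilde X_{n,i}'\widetilde X_{n,r})_{i,r=1}^{j}$ be their Gram matrix. Assume: (1) $\|X_n\|^2\to\sigma^2$ in probability as $n\to\infty$; (2) $X_n'\widetilde X_n\to0$ in probability as $n\to\infty$, where $\widetilde X_n$ is an independent copy of $X_n$; (3) $\mathbb{E}[(\det A_{n_0,k})^{-1/2}]<\infty$ for some positive integer $n_0$; (4) for every $n$, $\int_{-\infty}^{\infty}|\mathbb{E}\exp(\mathrm{i}t\,\theta'X_n)|\,dt<\infty$ for almost all $\theta$ in the unit sphere of $\mathbb{R}^{d_n}$; (5) there is a function $\psi:[0,\infty)\to\mathbb{R}$, not depending on $n$, with $\mathbb{E}\exp(\mathrm{i}u'\Xi_n)=\psi(\|u\|^2)$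 for all $n$ and all $u\in\mathbb{R}^{d_n}$. Let $G$ be the probability distribution on $[0,\infty)$ with $\psi(t)=\int_0^\infty e^{-tv^2/2}\,dG(v)$ for all $t\ge0$, and let $V$ be a random variable with distribution $G$; (6) $\mathbb{E}(V^{-k})=\int_0^\infty v^{-k}\,dG(v)<\infty$. Write $F_{Y_n|\Xi_n}$ for the conditional distribution function of $Y_n$ given $\Xi_n$, $F_{\mathcal N_1(0,s^2)}$ for the distribution function of the normal law with mean $0$ and variance $s^2$, $\|\cdot\|_F$ for the Frobenius norm, $I_j$ for the $j\times j$ identity matrix, and $$c_j=2^{-(j-2)/2}\,\pi^{-j/2}\,j^{5/4}\,\sigma^{-(j+1)}\,\mathbb{E}(V^{-j}).$$ Let $1\le j\le k$ and let $y,a\in\mathbb{R}$. Then there exists $n_j\in\mathbb{N}$ (which may depend on $y$ and $a$) such that, for all $n\ge n_j$, $$\Big|\mathbb{E}_{\Xi_n}\big[\big(F_{Y_n|\Xi_n}(y)-F_{Y_n|\Xi_n}(a)\big)^j\big]-\mathbb{E}_V\big[\big(F_{\mathcal N_1(0,\sigma^2V^2)}(y)-F_{\mathcal N_1(0,\sigma^2V^2)}(a)\big)^j\big]\Big|\le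 c_j\,|y-a|^j\,\big(\mathbb{E}\|A_{n,j}-\sigma^2I_j\|_F^2\big)^{1/4},$$ where the expectation on the right-hand side is allowed to be $+\infty$ (and $0\cdot\infty=0$). -/

import Mathlib

open MeasureTheory ProbabilityTheory Filter Topology
open scoped ENNReal NNReal

noncomputable section

namespace RandomModulation

/-- The modulated variable `Y = Ξ'X`. -/
def modulation {Ω : Type*} {m : ℕ} (X Ξ : Ω → EuclideanSpace ℝ (Fin m)) : Ω → ℝ :=
  fun ω => inner ℝ (Ξ ω) (X ω)

/-- The law of `k` mutually independent copies of a random element of `Ω`. The functions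
`ω ↦ X (ω i)` on `Fin k → Ω` are then `k` mutually independent copies of `X`. -/
def copies {Ω : Type*} [MeasurableSpace Ω] (μ : Measure Ω) (k : ℕ) : Measure (Fin k → Ω) :=
  Measure.pi (fun _ : Fin k => μ)

/-- The Gram matrix `A_k = (X̃_i'X̃_r)_{i,r}` of `k` independent copies `X̃_1, …, X̃_k` of `X`,
as a random matrix on `Fin k → Ω`. -/
def gramCopies {Ω : Type*} {m : ℕ} (X : Ω → EuclideanSpace ℝ (Fin m)) (k : ℕ)
    (ω : Fin k → Ω) : Matrix (Fin k) (Fin k) ℝ :=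
  Matrix.gram ℝ (fun i => X (ω i))

/-- `‖X_n‖² → σ²` in probability. -/
def ThinShell {Ω : Type*} [MeasurableSpace Ω] (μ : Measure Ω) {d : ℕ → ℕ}
    (X : ∀ n, Ω → EuclideanSpace ℝ (Fin (d n))) (σ : ℝ) : Prop :=
  TendstoInMeasure μ (fun n ω => ‖X n ω‖ ^ 2) atTop (fun _ => σ ^ 2)

/-- `X_n'X̃_n → 0` in probability, where `X̃_n` is an independent copy of `X_n`; the pair
`(X_n, X̃_n)` is realized on `Ω × Ω` with the product measure. -/
def ZeroOverlap {Ω : Type*} [MeasurableSpace Ω] (μ : Measure Ω) {d : ℕ → ℕ}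
    (X : ∀ n, Ω → EuclideanSpace ℝ (Fin (d n))) : Prop :=
  TendstoInMeasure (μ.prod μ) (fun n (p : Ω × Ω) => (inner ℝ (X n p.1) (X n p.2) : ℝ)) atTop
    (fun _ => 0)

/-- `E[(det A_{n₀,k})^{-1/2}] < ∞` for some `n₀`; the integrand is `∞` where the determinant
vanishes. -/
def GramDetMoment {Ω : Type*} [MeasurableSpace Ω] (μ : Measure Ω) {d : ℕ → ℕ}
    (X : ∀ n, Ω → EuclideanSpace ℝ (Fin (d n))) (k : ℕ) : Prop :=
  ∃ n₀ : ℕ, ∫⁻ ω, (ENNReal.ofReal (gramCopies (X n₀) k ω).det) ^ (-(1 / 2) : ℝ) ∂(copies μ k) < ∞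

/-- For almost every direction `θ` of the unit sphere, with respect to surface measure,
`t ↦ φ_X(tθ)` is integrable on the real line. -/
def IntegrableCF {Ω : Type*} [MeasurableSpace Ω] (μ : Measure Ω) {m : ℕ}
    (X : Ω → EuclideanSpace ℝ (Fin m)) : Prop :=
  ∀ᵐ θ : Metric.sphere (0 : EuclideanSpace ℝ (Fin m)) 1 ∂((volume : Measure (EuclideanSpace ℝ (Fin m))).toSphere),
    Integrable (fun t : ℝ => charFun (μ.map X) (t • (θ : EuclideanSpace ℝ (Fin m))))

/-- `G` is the distribution on `[0, ∞)` with `ψ(t) = ∫ exp(-t v²/2) dG(v)` for all `t ≥ 0`. -/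
structure IsMixingLaw (ψ : ℝ → ℝ) (G : Measure ℝ) : Prop where
  isProbabilityMeasure : IsProbabilityMeasure G
  nonneg : ∀ᵐ v ∂G, 0 ≤ v
  eq_integral : ∀ t : ℝ, 0 ≤ t → ψ t = ∫ v, Real.exp (-t * v ^ 2 / 2) ∂G

/-- `E(V^{-j}) = ∫ v^{-j} dG(v)` for a law `G` on `[0, ∞)`; the integrand is `∞` at `v = 0`
when `j ≥ 1`. -/
def negMoment (G : Measure ℝ) (j : ℕ) : ℝ≥0∞ :=
  ∫⁻ v, ((ENNReal.ofReal v)⁻¹) ^ j ∂G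

/-- The conditional distribution function `F_{Y|Ξ}(y)`, as a random variable. -/
def condCdf {Ω : Type*} [MeasurableSpace Ω] (μ : Measure Ω) [IsFiniteMeasure μ] {m : ℕ}
    (Y : Ω → ℝ) (Ξ : Ω → EuclideanSpace ℝ (Fin m)) (y : ℝ) (ω : Ω) : ℝ :=
  cdf (condDistrib Y Ξ μ (Ξ ω)) y

/-- The distribution function of the centred normal law with variance `s²`. -/
def normalCdf (s : ℝ) (y : ℝ) : ℝ :=
  cdf (gaussianReal 0 (Real.toNNReal (s ^ 2))) y

/-- The constant `c_j = 2^{-(j-2)/2} π^{-j/2} j^{5/4} σ^{-(j+1)} E(V^{-j})`. -/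
def lipConst (σ : ℝ) (G : Measure ℝ) (j : ℕ) : ℝ≥0∞ :=
  ENNReal.ofReal ((2 : ℝ) ^ (-(((j : ℝ) - 2) / 2)) * Real.pi ^ (-((j : ℝ) / 2)) *
    (j : ℝ) ^ (5 / 4 : ℝ) * (σ ^ (j + 1))⁻¹) * negMoment G j

section Frobenius

attribute [local instance] Matrix.frobeniusSeminormedAddCommGroup

/-- `E‖A_j - σ² I_j‖_F²`, in `[0, ∞]`, where `‖·‖_F` is the Frobenius norm. -/
def gramDeviation {Ω : Type*} [MeasurableSpace Ω] (μ : Measure Ω) {m : ℕ}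
    (X : Ω → EuclideanSpace ℝ (Fin m)) (σ : ℝ) (j : ℕ) : ℝ≥0∞ :=
  ∫⁻ ω, ENNReal.ofReal
    (‖gramCopies X j ω - σ ^ 2 • (1 : Matrix (Fin j) (Fin j) ℝ)‖ ^ 2) ∂(copies μ j)

end Frobenius

end RandomModulation

end

/-! The `j`-th power of an increment of the conditional distribution function is the conditional
probability that `j` independent copies of `X` all have inner product with `Ξ` in `(a, y]`. By
Fubini the copies may be fixed first. Since `Ξ` has the law of `V • Z` with `Z` standard Gaussian
independent of `V`, the inner products then have the law of `V • W` with `W` of law `N(0, A)`, `A`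
being the Gram matrix. The limiting moment is the same expression with `σ² I` in place of `A`. Hence
the error is at most `v n`, the mean of `min 1 (L ‖A - σ² I‖_F)` with `L = 2j / σ²`, by a total
variation bound that is uniform in `V`, `a` and `y` (`ofReal_abs_moment_sub_le`).

Two facts about `v n` remain. It tends to `0`, because `A → σ² I` in probability, and it is at most
`L δ^{1/2}` with `δ = E‖A - σ² I‖_F²`, by Cauchy–Schwarz. For any constant `C > 0` these give `v n ≤
C δ^{1/4}` eventually (`eventually_le_mul_rpow`): if `δ^{1/4} ≤ C / L` the second fact suffices,
otherwise `C δ^{1/4}` exceeds `C² / L` and the first does. Only positivity of `c_j |y - a|^j`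
matters, which is why the threshold may depend on `y` and `a`. -/

namespace RandomModulation

/-! ### Density of the standard Gaussian measure and linear images -/

section Gaussian

variable {E : Type*} [NormedAddCommGroup E] [InnerProductSpace ℝ E] [FiniteDimensional ℝ E]
  [MeasurableSpace E] [BorelSpace E]

/-- The density of the standard Gaussian measure on `E`, as a function of the norm. -/
noncomputable def gaussianDensity (n : ℕ) (r : ℝ) : ℝ :=
  ((2 * Real.pi) ^ ((n : ℝ) / 2))⁻¹ * Real.exp (-r ^ 2 / 2)

lemma gaussianDensity_nonneg (n : ℕ) (r : ℝ) : 0 ≤ gaussianDensity n r := by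
  unfold gaussianDensity; positivity

lemma gaussianDensity_anti (n : ℕ) {r s : ℝ} (hr : 0 ≤ r) (hrs : r ≤ s) :
    gaussianDensity n s ≤ gaussianDensity n r := by
  unfold gaussianDensity
  gcongr

lemma measurable_gaussianDensity (n : ℕ) : Measurable (gaussianDensity n) := by
  unfold gaussianDensity; fun_prop

/-- Both sides have the characteristic function `exp(-‖t‖² / 2)`; for the density this is the
Gaussian Fourier integral. -/
lemma stdGaussian_eq_withDensity :
    stdGaussian E = (volume : Measure E).withDensity
      (fun z => ENNReal.ofReal (gaussianDensity (Module.finrank ℝ E) ‖z‖)) := by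
  set n := Module.finrank ℝ E
  have hm : Measurable fun z : E => ENNReal.ofReal (gaussianDensity n ‖z‖) :=
    ((measurable_gaussianDensity n).comp measurable_norm).ennreal_ofReal
  have hint : Integrable (fun z : E => gaussianDensity n ‖z‖) := by
    have h := (GaussianFourier.integrable_cexp_neg_mul_sq_norm_add (V := E) (b := 1 / 2)
      (by norm_num) 0 0).norm
    refine (h.const_mul ((2 * Real.pi) ^ ((n : ℝ) / 2))⁻¹).congr (.of_forall fun z => ?_)
    simp only [gaussianDensity, Complex.norm_exp]
    congr 2
    simp [← Complex.ofReal_pow]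
    ring
  have : IsFiniteMeasure ((volume : Measure E).withDensity
      (fun z => ENNReal.ofReal (gaussianDensity n ‖z‖))) :=
    isFiniteMeasure_withDensity_ofReal hint.2
  apply Measure.ext_of_charFun
  ext t
  rw [charFun_stdGaussian, charFun_apply, integral_withDensity_eq_integral_toReal_smul hm
    (.of_forall fun _ => ENNReal.ofReal_lt_top)]
  have h := GaussianFourier.integral_cexp_neg_mul_sq_norm_add (V := E) (b := 1 / 2)
      (by norm_num) Complex.I t
  have h2 : ∀ z : E, (ENNReal.ofReal (gaussianDensity n ‖z‖)).toReal •
      Complex.exp (inner ℝ z t * Complex.I) =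
      (((2 * Real.pi) ^ ((n : ℝ) / 2) : ℝ) : ℂ)⁻¹ *
        Complex.exp (-(1 / 2) * ‖z‖ ^ 2 + Complex.I * inner ℝ t z) := by
    intro z
    rw [ENNReal.toReal_ofReal (gaussianDensity_nonneg _ _), gaussianDensity, Complex.real_smul,
      Complex.exp_add, real_inner_comm]
    push_cast
    rw [mul_assoc]
    congr 3
    · ring
    · ring
  simp_rw [h2]
  rw [integral_const_mul, h, Complex.ofReal_cpow (by positivity)]
  have h3 : ((2 * Real.pi : ℝ) : ℂ) ^ (((n : ℝ) / 2 : ℝ) : ℂ) ≠ 0 := by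
    rw [← Complex.ofReal_cpow (by positivity)]
    exact_mod_cast (by positivity : ((2 * Real.pi) ^ ((n : ℝ) / 2) : ℝ) ≠ 0)
  rw [show ((Real.pi : ℂ) / (1 / 2)) = ((2 * Real.pi : ℝ) : ℂ) by push_cast; ring,
    show (((n : ℝ) / 2 : ℝ) : ℂ) = (Module.finrank ℝ E : ℂ) / 2 by simp [n]] at *
  rw [inv_mul_cancel_left₀ h3, Complex.I_sq]
  congr 1
  ring

/-- An expanding linear map of bounded distortion keeps a definite proportion of the standard
Gaussian measure. -/
lemma inv_pow_mul_stdGaussian_le {N : E →ₗ[ℝ] E} {R : ℝ} (hR : 0 < R)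
    (h1 : ∀ z, ‖z‖ ≤ ‖N z‖) (h2 : ∀ z, ‖N z‖ ≤ R * ‖z‖) {B : Set E} (hB : MeasurableSet B) :
    ENNReal.ofReal ((R ^ Module.finrank ℝ E)⁻¹) * stdGaussian E B ≤ stdGaussian E (N ⁻¹' B) := by
  set n := Module.finrank ℝ E
  have hN : Measurable N := N.continuous_of_finiteDimensional.measurable
  have hm : Measurable fun z : E => ENNReal.ofReal (gaussianDensity n ‖z‖) :=
    ((measurable_gaussianDensity n).comp measurable_norm).ennreal_ofReal
  have hinj : Function.Injective N := by
    rw [← LinearMap.ker_eq_bot, LinearMap.ker_eq_bot']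
    intro z hz
    have := h1 z
    rw [hz, norm_zero] at this
    exact norm_le_zero_iff.1 this
  have hdet : LinearMap.det N ≠ 0 := by
    have := (LinearMap.isUnit_iff_ker_eq_bot N).2 (LinearMap.ker_eq_bot.2 hinj)
    exact (LinearMap.isUnit_iff_isUnit_det N |>.1 this).ne_zero
  -- Compare volumes: `N` maps the unit ball into the ball of radius `R`.
  have hdet_le : |LinearMap.det N| ≤ R ^ n := by
    have hsub : N '' Metric.closedBall 0 1 ⊆ Metric.closedBall 0 R := by
      rintro _ ⟨z, hz, rfl⟩
      rw [mem_closedBall_zero_iff] at hz ⊢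
      exact (h2 z).trans (by nlinarith)
    have h3 := measure_mono (μ := (volume : Measure E)) hsub
    rw [Measure.addHaar_image_linearMap, Measure.addHaar_closedBall' _ _ hR.le] at h3
    rw [ENNReal.mul_le_mul_iff_left (Metric.measure_closedBall_pos _ _ one_pos).ne'
      measure_closedBall_lt_top.ne] at h3
    exact (ENNReal.ofReal_le_ofReal_iff (by positivity)).1 h3
  rw [stdGaussian_eq_withDensity, withDensity_apply _ hB, withDensity_apply _ (hN hB)]
  calc ENNReal.ofReal ((R ^ n)⁻¹) * ∫⁻ z in B, ENNReal.ofReal (gaussianDensity n ‖z‖)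
      ≤ ENNReal.ofReal |(LinearMap.det N)⁻¹| * ∫⁻ z in B, ENNReal.ofReal (gaussianDensity n ‖z‖) := by
        gcongr
        rw [abs_inv]
        exact inv_anti₀ (abs_pos.2 hdet) hdet_le
    -- Change of variables; afterwards `‖z‖ ≤ ‖N z‖` and the density decreases with the norm.
    _ = ∫⁻ z in N ⁻¹' B, ENNReal.ofReal (gaussianDensity n ‖N z‖) := by
        rw [← setLIntegral_map hB hm hN, Measure.map_linearMap_addHaar_eq_smul_addHaar _ hdet,
          Measure.restrict_smul, lintegral_smul_measure, smul_eq_mul]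
    _ ≤ ∫⁻ z in N ⁻¹' B, ENNReal.ofReal (gaussianDensity n ‖z‖) := by
        gcongr with z
        exact gaussianDensity_anti _ (norm_nonneg _) (h1 z)

end Gaussian

/-! ### Domination of Gaussian laws by comparison of covariances -/

section Multivariate

open Matrix
open scoped MatrixOrder

variable {ι : Type*} [Fintype ι] [DecidableEq ι]

lemma norm_sq_toEuclideanCLM_sqrt {S : Matrix ι ι ℝ} (hS : S.PosSemidef) (x : EuclideanSpace ℝ ι) :
    ‖toEuclideanCLM (𝕜 := ℝ) (CFC.sqrt S) x‖ ^ 2 = x ⬝ᵥ S *ᵥ x := by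
  rw [← real_inner_self_eq_norm_sq, ← ContinuousLinearMap.adjoint_inner_right,
    IsSelfAdjoint.adjoint_eq, ← ContinuousLinearMap.comp_apply, ← ContinuousLinearMap.mul_def,
    ← map_mul, CFC.sqrt_mul_sqrt_self _ hS.nonneg, inner_toEuclideanCLM]
  exact (CFC.sqrt_nonneg S).isSelfAdjoint.map _

/-- A Gaussian law with covariance between `s² I` and `r² I` dominates a proportion of
the law `N(0, s² I)`. -/
lemma pow_mul_stdGaussian_le_multivariateGaussian {S : Matrix ι ι ℝ} (hS : S.PosSemidef)
    {s r : ℝ} (hs : 0 < s) (hr : 0 < r)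
    (h1 : ∀ x : EuclideanSpace ℝ ι, s ^ 2 * ‖x‖ ^ 2 ≤ x ⬝ᵥ S *ᵥ x)
    (h2 : ∀ x : EuclideanSpace ℝ ι, x ⬝ᵥ S *ᵥ x ≤ r ^ 2 * ‖x‖ ^ 2)
    {B : Set (EuclideanSpace ℝ ι)} (hB : MeasurableSet B) :
    (s / r) ^ Fintype.card ι * (stdGaussian (EuclideanSpace ℝ ι)).real ((fun z => s • z) ⁻¹' B)
      ≤ (multivariateGaussian 0 S).real B := by
  set M := toEuclideanCLM (𝕜 := ℝ) (CFC.sqrt S)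
  have hM := norm_sq_toEuclideanCLM_sqrt hS
  have e1 : ∀ x, s * ‖x‖ ≤ ‖M x‖ := fun x =>
    le_of_sq_le_sq (by rw [mul_pow, hM]; exact h1 x) (norm_nonneg _)
  have e2 : ∀ x, ‖M x‖ ≤ r * ‖x‖ := fun x =>
    le_of_sq_le_sq (by rw [mul_pow, hM]; exact h2 x) (by positivity)
  -- After rescaling by `s⁻¹`, the square root of `S` is expanding with norm at most `r / s`.
  have key := inv_pow_mul_stdGaussian_le (N := s⁻¹ • (M : EuclideanSpace ℝ ι →ₗ[ℝ] _))
    (R := r / s) (by positivity) (fun z => by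
      simp only [LinearMap.smul_apply, ContinuousLinearMap.coe_coe, norm_smul, norm_inv,
        Real.norm_of_nonneg hs.le]
      rw [inv_mul_eq_div, le_div_iff₀ hs, mul_comm]; exact e1 z) (fun z => by
      simp only [LinearMap.smul_apply, ContinuousLinearMap.coe_coe, norm_smul, norm_inv,
        Real.norm_of_nonneg hs.le]
      rw [inv_mul_eq_div, div_mul_eq_mul_div]
      gcongr
      exact e2 z) (B := (fun z => s • z) ⁻¹' B) ((measurable_const_smul s) hB)
  have hpre : (s⁻¹ • (M : EuclideanSpace ℝ ι →ₗ[ℝ] EuclideanSpace ℝ ι)) ⁻¹'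
      ((fun z => s • z) ⁻¹' B) = M ⁻¹' B := by
    ext z
    simp [smul_smul, hs.ne']
  have hmap : multivariateGaussian 0 S B = stdGaussian (EuclideanSpace ℝ ι) (M ⁻¹' B) := by
    rw [multivariateGaussian, Measure.map_apply (by fun_prop) hB]
    simp [M]
  rw [hpre, ← hmap, finrank_euclideanSpace, ← inv_pow, inv_div] at key
  have := ENNReal.toReal_mono (measure_ne_top _ _) key
  rwa [ENNReal.toReal_mul, ENNReal.toReal_ofReal (by positivity)] at this

end Multivariate

/-! ### Total variation distance between centred Gaussian laws -/

section TotalVariation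

open Matrix

variable {ι : Type*} [Fintype ι] [DecidableEq ι]

/-- Total variation distance between centred Gaussian laws: the distance to `N(0, σ² I)` is
controlled by the numerical radius of the difference of the covariances. -/
lemma abs_multivariateGaussian_sub_le [Nonempty ι] {S : Matrix ι ι ℝ} (hS : S.PosSemidef)
    {σ D : ℝ} (hσ : 0 < σ) (hD : 0 ≤ D)
    (h : ∀ x : EuclideanSpace ℝ ι, |x ⬝ᵥ S *ᵥ x - σ ^ 2 * ‖x‖ ^ 2| ≤ D * ‖x‖ ^ 2)
    {B : Set (EuclideanSpace ℝ ι)} (hB : MeasurableSet B) :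
    |(multivariateGaussian 0 S).real B - (multivariateGaussian 0 (σ ^ 2 • (1 : Matrix ι ι ℝ))).real B|
      ≤ 2 * Fintype.card ι / σ ^ 2 * D := by
  set n := Fintype.card ι
  have hn : (1 : ℝ) ≤ n := by exact_mod_cast Fintype.card_pos
  set ρ := D / σ ^ 2 with hρ
  have hρ0 : 0 ≤ ρ := by positivity
  have hDρ : D = ρ * σ ^ 2 := by rw [hρ]; field_simp
  have hgoal : 2 * n / σ ^ 2 * D = 2 * n * ρ := by rw [hρ]; ring
  rw [hgoal]
  have b0 (T : Matrix ι ι ℝ) : 0 ≤ (multivariateGaussian 0 T).real B := measureReal_nonneg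
  have b1 (T : Matrix ι ι ℝ) : (multivariateGaussian 0 T).real B ≤ 1 := measureReal_le_one
  -- For `ρ > 1/2` the bound exceeds `1` and is trivial. Otherwise the covariance lies between `s²
  -- I` and `r² I`.
  rcases lt_or_ge (1 / 2) ρ with hlt | hle
  · rw [abs_le]
    constructor <;> nlinarith [b0 S, b1 S, b0 (σ ^ 2 • 1), b1 (σ ^ 2 • 1)]
  set s := Real.sqrt ((1 - ρ) * σ ^ 2)
  set r := Real.sqrt ((1 + ρ) * σ ^ 2)
  have hs : 0 < s := Real.sqrt_pos.2 (mul_pos (by linarith) (by positivity))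
  have hr : 0 < r := Real.sqrt_pos.2 (mul_pos (by linarith) (by positivity))
  have hs2 : s ^ 2 = (1 - ρ) * σ ^ 2 := Real.sq_sqrt (mul_nonneg (by linarith) (by positivity))
  have hr2 : r ^ 2 = (1 + ρ) * σ ^ 2 := Real.sq_sqrt (mul_nonneg (by linarith) (by positivity))
  set c := (s / r) ^ n
  have hq1 : s / r ≤ 1 := by
    rw [div_le_one hr]
    exact Real.sqrt_le_sqrt (by nlinarith [sq_nonneg σ])
  have hc : 1 - 2 * n * ρ ≤ c := by
    -- Since `s / r ≤ 1`, it is at least its square `(1 - ρ) / (1 + ρ)`; Bernoulli's inequality then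
    -- handles the power.
    have h3 : 1 + -(2 * ρ) ≤ s / r := by
      have h4 : (s / r) ^ 2 = (1 - ρ) / (1 + ρ) := by
        rw [div_pow, hs2, hr2, mul_div_mul_right _ _ (by positivity)]
      have h5 : 1 + -(2 * ρ) ≤ (1 - ρ) / (1 + ρ) := by
        rw [le_div_iff₀ (by linarith)]; nlinarith
      nlinarith [div_pos hs hr]
    calc 1 - 2 * n * ρ = 1 + n * (-(2 * ρ)) := by ring
      _ ≤ (1 + -(2 * ρ)) ^ n := one_add_mul_le_pow (by linarith) n
      _ ≤ c := pow_le_pow_left₀ (by linarith) h3 n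
  -- Both laws contain the common part `c · N(0, s² I)`. Testing on `B` and on its complement puts
  -- both probabilities of `B` in one interval of length `1 - c`.
  have key : ∀ T : Matrix ι ι ℝ, T.PosSemidef →
      (∀ x : EuclideanSpace ℝ ι, |x ⬝ᵥ T *ᵥ x - σ ^ 2 * ‖x‖ ^ 2| ≤ D * ‖x‖ ^ 2) →
      c * (stdGaussian (EuclideanSpace ℝ ι)).real ((fun z => s • z) ⁻¹' B)
        ≤ (multivariateGaussian 0 T).real B ∧
      c * (1 - (stdGaussian (EuclideanSpace ℝ ι)).real ((fun z => s • z) ⁻¹' B))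
        ≤ 1 - (multivariateGaussian 0 T).real B := by
    intro T hT hTD
    have t1 : ∀ x : EuclideanSpace ℝ ι, s ^ 2 * ‖x‖ ^ 2 ≤ x ⬝ᵥ T *ᵥ x := fun x => by
      have := (abs_le.1 (hTD x)).1
      rw [hs2]; rw [hDρ] at this; linarith
    have t2 : ∀ x : EuclideanSpace ℝ ι, x ⬝ᵥ T *ᵥ x ≤ r ^ 2 * ‖x‖ ^ 2 := fun x => by
      have := (abs_le.1 (hTD x)).2
      rw [hr2]; rw [hDρ] at this; linarith
    have hB' : MeasurableSet ((fun z : EuclideanSpace ℝ ι => s • z) ⁻¹' B) :=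
      (measurable_const_smul s) hB
    refine ⟨pow_mul_stdGaussian_le_multivariateGaussian hT hs hr t1 t2 hB, ?_⟩
    have := pow_mul_stdGaussian_le_multivariateGaussian hT hs hr t1 t2 hB.compl
    rwa [Set.preimage_compl, probReal_compl_eq_one_sub hB', probReal_compl_eq_one_sub hB] at this
  have k1 := key S hS h
  have hI : (σ ^ 2 • (1 : Matrix ι ι ℝ)).PosSemidef := Matrix.PosSemidef.one.smul (sq_nonneg σ)
  have k2 := key _ hI (fun x => by
    rw [Matrix.smul_mulVec, Matrix.one_mulVec, dotProduct_smul, EuclideanSpace.real_norm_sq_eq]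
    simp only [dotProduct, smul_eq_mul, ← pow_two, sub_self, abs_zero]
    positivity)
  rw [abs_le]
  constructor <;> linarith [k1.1, k1.2, k2.1, k2.2]

omit [DecidableEq ι] in
lemma abs_dotProduct_mulVec_le (M : Matrix ι ι ℝ) (x : EuclideanSpace ℝ ι) :
    |x ⬝ᵥ M *ᵥ x| ≤ Real.sqrt (∑ i, ∑ k, M i k ^ 2) * ‖x‖ ^ 2 := by
  apply abs_le_of_sq_le_sq _ (by positivity)
  rw [mul_pow, Real.sq_sqrt (by positivity), EuclideanSpace.real_norm_sq_eq]
  -- Cauchy–Schwarz over pairs of indices, pairing `M` with the rank-one matrix `x xᵀ`.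
  have h := Finset.sum_mul_sq_le_sq_mul_sq (Finset.univ : Finset (ι × ι))
    (fun p => M p.1 p.2) (fun p => x p.1 * x p.2)
  simp only [Fintype.sum_prod_type] at h
  convert h using 2
  · simp only [dotProduct, mulVec, Finset.mul_sum]
    exact Finset.sum_congr rfl fun i _ => Finset.sum_congr rfl fun k _ => by ring
  · rw [pow_two, Finset.sum_mul_sum]
    exact Finset.sum_congr rfl fun i _ => Finset.sum_congr rfl fun k _ => by ring

/-- The law `N(0, S)` is within `2 card ι / σ² · ‖S - σ² I‖_F` of `N(0, σ² I)`
in total variation. -/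
lemma abs_multivariateGaussian_sub_le_frobenius [Nonempty ι] {S : Matrix ι ι ℝ}
    (hS : S.PosSemidef) {σ : ℝ} (hσ : 0 < σ)
    {B : Set (EuclideanSpace ℝ ι)} (hB : MeasurableSet B) :
    |(multivariateGaussian 0 S).real B - (multivariateGaussian 0 (σ ^ 2 • (1 : Matrix ι ι ℝ))).real B|
      ≤ 2 * Fintype.card ι / σ ^ 2 *
        Real.sqrt (∑ i, ∑ k, (S - σ ^ 2 • (1 : Matrix ι ι ℝ)) i k ^ 2) := by
  refine abs_multivariateGaussian_sub_le hS hσ (Real.sqrt_nonneg _) (fun x => ?_) hB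
  convert abs_dotProduct_mulVec_le (S - σ ^ 2 • (1 : Matrix ι ι ℝ)) x using 2
  rw [Matrix.sub_mulVec, Matrix.smul_mulVec, Matrix.one_mulVec, dotProduct_sub, dotProduct_smul,
    EuclideanSpace.real_norm_sq_eq]
  simp only [dotProduct, smul_eq_mul, ← pow_two]

end TotalVariation

/-! ### Frobenius norm in coordinates -/

section Frobenius

attribute [local instance] Matrix.frobeniusSeminormedAddCommGroup

lemma frobenius_norm_eq_sqrt {ι : Type*} [Fintype ι] (M : Matrix ι ι ℝ) :
    ‖M‖ = Real.sqrt (∑ i, ∑ k, M i k ^ 2) := by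
  have := Matrix.frobenius_norm_def M
  rw [Real.sqrt_eq_rpow]
  simpa using this

lemma gramDeviation_eq {Ω : Type*} [MeasurableSpace Ω] (μ : Measure Ω) {m : ℕ}
    (X : Ω → EuclideanSpace ℝ (Fin m)) (σ : ℝ) (j : ℕ) :
    gramDeviation μ X σ j = ∫⁻ ω, ENNReal.ofReal (Real.sqrt (∑ i, ∑ k,
      (gramCopies X j ω - σ ^ 2 • (1 : Matrix (Fin j) (Fin j) ℝ)) i k ^ 2)) ^ (2 : ℝ)
      ∂(copies μ j) := by
  unfold gramDeviation
  refine lintegral_congr fun ω => ?_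
  rw [ENNReal.rpow_two, ← ENNReal.ofReal_pow (Real.sqrt_nonneg _), frobenius_norm_eq_sqrt]

end Frobenius

/-! ### Conditional distribution functions and independent copies -/

section Conditioning

/-- By independence the pair `(Ξ, X)` has a product law, so freezing `Ξ = ξ` disintegrates the law
of `(Ξ, f (Ξ, X))`; disintegrations are almost surely unique. -/
lemma condDistrib_ae_eq_map_of_indepFun {Ω α β γ : Type*} [MeasurableSpace Ω] [MeasurableSpace α]
    [MeasurableSpace β] [MeasurableSpace γ] [StandardBorelSpace γ] [Nonempty γ]
    {μ : Measure Ω} [IsProbabilityMeasure μ] {X : Ω → α} {Ξ : Ω → β} (hX : Measurable X)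
    (hΞ : Measurable Ξ) (h : IndepFun X Ξ μ) {f : β × α → γ} (hf : Measurable f) :
    ∀ᵐ ω ∂μ, condDistrib (fun ω => f (Ξ ω, X ω)) Ξ μ (Ξ ω) =
      (μ.map X).map (fun x => f (Ξ ω, x)) := by
  have : IsProbabilityMeasure (μ.map X) := Measure.isProbabilityMeasure_map hX.aemeasurable
  have : IsProbabilityMeasure (μ.map Ξ) := Measure.isProbabilityMeasure_map hΞ.aemeasurable
  let κ : Kernel β γ := (Kernel.id ×ₖ Kernel.const β (μ.map X)).map f
  have : IsMarkovKernel κ := Kernel.IsMarkovKernel.map _ hf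
  have hκ : ∀ ξ, κ ξ = (μ.map X).map (fun x => f (ξ, x)) := by
    intro ξ
    rw [Kernel.map_apply _ hf, Kernel.prod_apply, Kernel.id_apply, Kernel.const_apply,
      Measure.dirac_prod, Measure.map_map hf measurable_prodMk_left]
    rfl
  have hae : condDistrib (fun ω => f (Ξ ω, X ω)) Ξ μ =ᵐ[μ.map Ξ] κ := by
    refine condDistrib_ae_eq_of_measure_eq_compProd Ξ
      (hf.comp (hΞ.prodMk hX)).aemeasurable ?_
    ext s hs
    have hg : Measurable fun p : β × α => (p.1, f p) := measurable_fst.prodMk hf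
    have hprod := (indepFun_iff_map_prod_eq_prod_map_map hΞ.aemeasurable hX.aemeasurable).1 h.symm
    change Measure.map ((fun p : β × α => (p.1, f p)) ∘ fun ω => (Ξ ω, X ω)) μ s = _
    rw [Measure.compProd_apply hs, ← Measure.map_map hg (hΞ.prodMk hX), hprod, Measure.map_apply hg hs,
      Measure.prod_apply (hg hs)]
    refine lintegral_congr fun ξ => ?_
    have hfξ : Measurable fun x => f (ξ, x) := hf.comp measurable_prodMk_left
    rw [hκ, Measure.map_apply hfξ (measurable_prodMk_left hs)]
    rfl
  filter_upwards [ae_of_ae_map hΞ.aemeasurable hae] with ω hω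
  rw [hω, hκ]

lemma cdf_sub_cdf (P : Measure ℝ) [IsProbabilityMeasure P] {a y : ℝ} (h : a ≤ y) :
    cdf P y - cdf P a = P.real (Set.Ioc a y) := by
  have hset : Set.Ioc a y = Set.Iic y \ Set.Iic a := by ext; simp [and_comm]
  rw [cdf_eq_real, cdf_eq_real, hset, measureReal_sdiff (Set.Iic_subset_Iic.2 h)
    measurableSet_Iic]

variable {Ω : Type*} [MeasurableSpace Ω] {μ : Measure Ω} [IsProbabilityMeasure μ] {m : ℕ}
  {X Ξ : Ω → EuclideanSpace ℝ (Fin m)}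

lemma condCdf_sub_condCdf (hX : Measurable X) (hΞ : Measurable Ξ) (h : IndepFun X Ξ μ)
    {a y : ℝ} (hay : a ≤ y) :
    ∀ᵐ ω ∂μ, condCdf μ (modulation X Ξ) Ξ y ω - condCdf μ (modulation X Ξ) Ξ a ω =
      μ.real {ω' | inner ℝ (Ξ ω) (X ω') ∈ Set.Ioc a y} := by
  have hf : Measurable fun p : EuclideanSpace ℝ (Fin m) × EuclideanSpace ℝ (Fin m) =>
    (inner ℝ p.1 p.2 : ℝ) := by fun_prop
  filter_upwards [condDistrib_ae_eq_map_of_indepFun hX hΞ h hf] with ω hω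
  unfold condCdf modulation
  rw [cdf_sub_cdf _ hay, hω, map_measureReal_apply (by fun_prop) measurableSet_Ioc,
    map_measureReal_apply hX (by measurability)]
  rfl

/-- Moments of increments of the conditional distribution function, through independent copies
of `X`. -/
lemma integral_condCdf_sub_pow (hX : Measurable X) (hΞ : Measurable Ξ) (h : IndepFun X Ξ μ)
    {a y : ℝ} (hay : a ≤ y) (j : ℕ) :
    ∫ ω, (condCdf μ (modulation X Ξ) Ξ y ω - condCdf μ (modulation X Ξ) Ξ a ω) ^ j ∂μ =
      ∫ ω, (μ.map Ξ).real {ξ | ∀ i : Fin j, inner ℝ ξ (X (ω i)) ∈ Set.Ioc a y} ∂(copies μ j) ∧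
    Measurable (fun ω : Fin j → Ω => (μ.map Ξ).real {ξ | ∀ i : Fin j, inner ℝ ξ (X (ω i)) ∈ Set.Ioc a y}) := by
  have : IsProbabilityMeasure (μ.map Ξ) := Measure.isProbabilityMeasure_map hΞ.aemeasurable
  have : IsProbabilityMeasure (copies μ j) := by unfold copies; infer_instance
  have hs : MeasurableSet {p : EuclideanSpace ℝ (Fin m) × (Fin j → Ω) |
      ∀ i, (inner ℝ p.1 (X (p.2 i)) : ℝ) ∈ Set.Ioc a y} := by
    rw [Set.ofPred_forall]
    refine MeasurableSet.iInter fun i => ?_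
    have : Measurable fun p : EuclideanSpace ℝ (Fin m) × (Fin j → Ω) =>
      (inner ℝ p.1 (X (p.2 i)) : ℝ) := by fun_prop
    exact this measurableSet_Ioc
  have hm2 := measurable_measure_prodMk_right (μ := μ.map Ξ) hs
  refine ⟨?_, hm2.ennreal_toReal⟩
  have hm1 := measurable_measure_prodMk_left (ν := copies μ j) hs
  have e1 : ∫ ω, (condCdf μ (modulation X Ξ) Ξ y ω - condCdf μ (modulation X Ξ) Ξ a ω) ^ j ∂μ =
      ∫ ω, (copies μ j).real {ω' | ∀ i, inner ℝ (Ξ ω) (X (ω' i)) ∈ Set.Ioc a y} ∂μ := by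
    refine integral_congr_ae ?_
    filter_upwards [condCdf_sub_condCdf hX hΞ h hay] with ω hω
    rw [hω]
    have : {ω' : Fin j → Ω | ∀ i, (inner ℝ (Ξ ω) (X (ω' i)) : ℝ) ∈ Set.Ioc a y} =
      Set.univ.pi fun _ => {ω' | (inner ℝ (Ξ ω) (X ω') : ℝ) ∈ Set.Ioc a y} := by
      ext; simp
    rw [this, measureReal_def, measureReal_def, copies, Measure.pi_pi]
    simp
  rw [e1, ← integral_map (φ := Ξ) (f := fun ξ =>
    (copies μ j).real {ω' | ∀ i, inner ℝ ξ (X (ω' i)) ∈ Set.Ioc a y}) hΞ.aemeasurable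
    hm1.ennreal_toReal.aestronglyMeasurable]
  -- Fubini: both iterated integrals equal the product measure of the set in `hs`.
  have e2 := integral_toReal (μ := μ.map Ξ) hm1.aemeasurable (.of_forall fun _ => measure_lt_top _ _)
  have e3 := integral_toReal (μ := copies μ j) hm2.aemeasurable
    (.of_forall fun _ => measure_lt_top _ _)
  rw [← Measure.prod_apply hs] at e2
  rw [← Measure.prod_apply_symm hs] at e3
  exact e2.trans e3.symm

end Conditioning

/-! ### Scale mixtures of Gaussian laws -/

section Mixture

/-- Conditionally on `v`, the characteristic function of `v • Z` at `u` is `exp(-v² ‖u‖² / 2)`;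
averaging over `G` gives `ψ (‖u‖²)`. -/
lemma map_eq_map_smul_stdGaussian {Ω : Type*} [MeasurableSpace Ω] {μ : Measure Ω}
    [IsProbabilityMeasure μ] {m : ℕ} {Ξ : Ω → EuclideanSpace ℝ (Fin m)} {ψ : ℝ → ℝ}
    (hψ : ∀ u, charFun (μ.map Ξ) u = ((ψ (‖u‖ ^ 2) : ℝ) : ℂ)) {G : Measure ℝ}
    (hG : IsMixingLaw ψ G) :
    μ.map Ξ = (G.prod (stdGaussian (EuclideanSpace ℝ (Fin m)))).map (fun p => p.1 • p.2) := by
  have := hG.isProbabilityMeasure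
  apply Measure.ext_of_charFun
  ext u
  have hmeas : Measurable fun p : ℝ × EuclideanSpace ℝ (Fin m) => p.1 • p.2 := by fun_prop
  rw [hψ, hG.eq_integral _ (sq_nonneg _), charFun_apply, integral_map hmeas.aemeasurable
    (by fun_prop)]
  rw [integral_prod]
  · rw [← integral_complex_ofReal]
    refine integral_congr_ae (.of_forall fun v => ?_)
    simp only
    have : ∀ z : EuclideanSpace ℝ (Fin m), (inner ℝ (v • z) u : ℝ) = inner ℝ z (v • u) := by
      intro z; rw [real_inner_smul_left, real_inner_smul_right]
    simp_rw [this]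
    rw [← charFun_apply, charFun_stdGaussian, norm_smul]
    rw [← Complex.ofReal_pow, mul_pow, Real.norm_eq_abs, sq_abs]
    push_cast
    congr 1
    ring
  · refine Integrable.of_bound (C := 1) (by fun_prop) (.of_forall fun p => ?_)
    rw [Complex.norm_exp_ofReal_mul_I]

-- Testing against `t` gives the inner product of `z` with `∑ i, t i • x i`, whose squared norm is
-- the quadratic form of the Gram matrix at `t`.
open Matrix in
lemma map_inner_stdGaussian {m j : ℕ} (x : Fin j → EuclideanSpace ℝ (Fin m)) :
    (stdGaussian (EuclideanSpace ℝ (Fin m))).map (fun z => WithLp.toLp 2 fun i => inner ℝ z (x i)) =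
      multivariateGaussian 0 (Matrix.gram ℝ x) := by
  have hmeas : Measurable fun z : EuclideanSpace ℝ (Fin m) =>
    (WithLp.toLp 2 fun i => inner ℝ z (x i) : EuclideanSpace ℝ (Fin j)) := by fun_prop
  have := Measure.isProbabilityMeasure_map (μ := stdGaussian (EuclideanSpace ℝ (Fin m)))
    hmeas.aemeasurable
  apply Measure.ext_of_charFun
  ext t
  rw [charFun_multivariateGaussian (Matrix.posSemidef_gram ℝ x), charFun_apply,
    integral_map hmeas.aemeasurable (by fun_prop)]
  have h1 : ∀ z : EuclideanSpace ℝ (Fin m),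
      (inner ℝ (WithLp.toLp 2 fun i => inner ℝ z (x i) : EuclideanSpace ℝ (Fin j)) t : ℝ) =
        inner ℝ z (∑ i, t i • x i) := by
    intro z
    rw [inner_sum, PiLp.inner_apply]
    simp_rw [real_inner_smul_right]
    rfl
  simp_rw [h1]
  have h2 := star_dotProduct_gram_mulVec (𝕜 := ℝ) x (t : Fin j → ℝ) t
  rw [star_trivial] at h2
  rw [← charFun_apply, charFun_stdGaussian, h2, real_inner_self_eq_norm_sq]
  simp [neg_div]

lemma measurableSet_scaled_box {j : ℕ} (a y v : ℝ) :
    MeasurableSet {w : EuclideanSpace ℝ (Fin j) | ∀ i, v * w i ∈ Set.Ioc a y} := by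
  rw [Set.ofPred_forall]
  refine MeasurableSet.iInter fun i => ?_
  have : Measurable fun w : EuclideanSpace ℝ (Fin j) => v * w i := by fun_prop
  exact this measurableSet_Ioc

lemma measurable_real_scaled_box {j : ℕ} (a y : ℝ) (P : Measure (EuclideanSpace ℝ (Fin j)))
    [IsProbabilityMeasure P] :
    Measurable fun v : ℝ => P.real {w | ∀ i, v * w i ∈ Set.Ioc a y} := by
  have hs : MeasurableSet {p : ℝ × EuclideanSpace ℝ (Fin j) |
      ∀ i, p.1 * p.2 i ∈ Set.Ioc a y} := by
    rw [Set.ofPred_forall]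
    refine MeasurableSet.iInter fun i => ?_
    have : Measurable fun p : ℝ × EuclideanSpace ℝ (Fin j) => p.1 * p.2 i := by fun_prop
    exact this measurableSet_Ioc
  exact (measurable_measure_prodMk_left (ν := P) hs).ennreal_toReal

/-- The probability that a scale mixture of Gaussians has its inner products with given vectors
in an interval. -/
lemma map_real_forall_inner_mem {Ω : Type*} [MeasurableSpace Ω] {μ : Measure Ω}
    [IsProbabilityMeasure μ] {m : ℕ} {Ξ : Ω → EuclideanSpace ℝ (Fin m)} {ψ : ℝ → ℝ}
    (hψ : ∀ u, charFun (μ.map Ξ) u = ((ψ (‖u‖ ^ 2) : ℝ) : ℂ)) {G : Measure ℝ}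
    (hG : IsMixingLaw ψ G) {j : ℕ} (x : Fin j → EuclideanSpace ℝ (Fin m)) (a y : ℝ) :
    (μ.map Ξ).real {ξ | ∀ i, inner ℝ ξ (x i) ∈ Set.Ioc a y} =
      ∫ v, (multivariateGaussian 0 (Matrix.gram ℝ x)).real {w | ∀ i, v * w i ∈ Set.Ioc a y} ∂G := by
  have := hG.isProbabilityMeasure
  have hs : MeasurableSet {ξ : EuclideanSpace ℝ (Fin m) |
      ∀ i, (inner ℝ ξ (x i) : ℝ) ∈ Set.Ioc a y} := by
    rw [Set.ofPred_forall]
    refine MeasurableSet.iInter fun i => ?_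
    have : Measurable fun ξ : EuclideanSpace ℝ (Fin m) => (inner ℝ ξ (x i) : ℝ) := by fun_prop
    exact this measurableSet_Ioc
  have hmeas : Measurable fun p : ℝ × EuclideanSpace ℝ (Fin m) => p.1 • p.2 := by fun_prop
  have hT : Measurable fun z : EuclideanSpace ℝ (Fin m) =>
    (WithLp.toLp 2 fun i => inner ℝ z (x i) : EuclideanSpace ℝ (Fin j)) := by fun_prop
  rw [map_eq_map_smul_stdGaussian hψ hG, map_measureReal_apply hmeas hs, measureReal_def,
    Measure.prod_apply (hmeas hs), ← integral_toReal
      (measurable_measure_prodMk_left (hmeas hs)).aemeasurable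
      (.of_forall fun _ => measure_lt_top _ _)]
  refine integral_congr_ae (.of_forall fun v => ?_)
  simp only
  rw [← map_inner_stdGaussian, map_measureReal_apply hT (measurableSet_scaled_box a y v),
    measureReal_def]
  congr 2
  ext z
  simp [real_inner_smul_left]

lemma multivariateGaussian_smul_one (j : ℕ) (σ : ℝ) :
    multivariateGaussian 0 (σ ^ 2 • (1 : Matrix (Fin j) (Fin j) ℝ)) =
      (Measure.pi fun _ : Fin j => gaussianReal 0 1).map
        (fun z => (WithLp.toLp 2 fun i => σ * z i : EuclideanSpace ℝ (Fin j))) := by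
  have h : (fun z : Fin j → ℝ => (WithLp.toLp 2 fun i => σ * z i : EuclideanSpace ℝ (Fin j))) =
      (fun z : EuclideanSpace ℝ (Fin j) => σ • z) ∘ WithLp.toLp 2 := by
    ext; simp
  rw [h, ← Measure.map_map (by fun_prop) (by fun_prop), map_pi_eq_stdGaussian]
  apply Measure.ext_of_charFun
  ext t
  rw [charFun_multivariateGaussian (Matrix.PosSemidef.one.smul (sq_nonneg σ)), charFun_map_smul,
    charFun_stdGaussian, norm_smul, ← Complex.ofReal_pow, mul_pow, Real.norm_eq_abs, sq_abs, Matrix.smul_mulVec,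
    Matrix.one_mulVec, dotProduct_smul, EuclideanSpace.real_norm_sq_eq]
  simp [dotProduct, neg_div, pow_two]

/-- The coordinates under `N(0, σ² I)` are independent, so the box probability factors. This puts
the limit in the same form as `map_real_forall_inner_mem`. -/
lemma normalCdf_sub_normalCdf_pow (σ v : ℝ) {a y : ℝ} (hay : a ≤ y) (j : ℕ) :
    (normalCdf (σ * v) y - normalCdf (σ * v) a) ^ j =
      (multivariateGaussian 0 (σ ^ 2 • (1 : Matrix (Fin j) (Fin j) ℝ))).real
        {w | ∀ i, v * w i ∈ Set.Ioc a y} := by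
  have hmap : gaussianReal 0 (Real.toNNReal ((σ * v) ^ 2)) =
      (gaussianReal 0 1).map (fun t => (σ * v) * t) := by
    rw [gaussianReal_map_const_mul, mul_zero, mul_one]
    congr 1
    exact Real.toNNReal_of_nonneg (sq_nonneg _)
  have hpre : (fun z : Fin j → ℝ => (WithLp.toLp 2 fun i => σ * z i : EuclideanSpace ℝ (Fin j))) ⁻¹'
      {w | ∀ i, v * w i ∈ Set.Ioc a y} =
      Set.univ.pi fun _ => (fun t => (σ * v) * t) ⁻¹' Set.Ioc a y := by
    ext z
    simp [mul_left_comm v σ, mul_assoc]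
  unfold normalCdf
  rw [cdf_sub_cdf _ hay, multivariateGaussian_smul_one, map_measureReal_apply (by fun_prop)
    (measurableSet_scaled_box a y v), hpre, hmap, map_measureReal_apply (by fun_prop)
    measurableSet_Ioc, measureReal_def, measureReal_def, Measure.pi_pi]
  simp

end Mixture

/-- The Frobenius distance of the Gram matrix from `σ² I`. -/
noncomputable def gramDist {Ω : Type*} {m : ℕ} (X : Ω → EuclideanSpace ℝ (Fin m)) (σ : ℝ) (j : ℕ)
    (ω : Fin j → Ω) : ℝ :=
  Real.sqrt (∑ i, ∑ k, (gramCopies X j ω - σ ^ 2 • (1 : Matrix (Fin j) (Fin j) ℝ)) i k ^ 2)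

lemma measurable_gramCopies_sub {Ω : Type*} [MeasurableSpace Ω] {m j : ℕ}
    {X : Ω → EuclideanSpace ℝ (Fin m)} (hX : Measurable X) (σ : ℝ) (i k : Fin j) :
    Measurable fun ω =>
      (gramCopies X j ω - σ ^ 2 • (1 : Matrix (Fin j) (Fin j) ℝ)) i k := by
  simp only [gramCopies, Matrix.sub_apply, Matrix.gram_apply]
  fun_prop

lemma measurable_gramDist {Ω : Type*} [MeasurableSpace Ω] {m : ℕ}
    {X : Ω → EuclideanSpace ℝ (Fin m)} (hX : Measurable X) (σ : ℝ) (j : ℕ) :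
    Measurable (gramDist X σ j) := by
  unfold gramDist
  refine Measurable.sqrt (Finset.measurable_sum _ fun i _ => Finset.measurable_sum _ fun k _ => ?_)
  exact (measurable_gramCopies_sub hX σ i k).pow_const 2

/-! ### Bounding the error by the Gram matrix deviation -/

section Bound

variable {Ω : Type*} [MeasurableSpace Ω] {μ : Measure Ω} [IsProbabilityMeasure μ]

/-- For fixed copies and fixed `v`, two Gaussian laws are compared on the same box. The truncation
at `1` makes convergence in probability of the Gram matrix enough for the limit. -/
lemma ofReal_abs_moment_sub_le {m : ℕ} {X Ξ : Ω → EuclideanSpace ℝ (Fin m)} (hX : Measurable X)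
    (hΞ : Measurable Ξ) (h : IndepFun X Ξ μ) {ψ : ℝ → ℝ}
    (hψ : ∀ u, charFun (μ.map Ξ) u = ((ψ (‖u‖ ^ 2) : ℝ) : ℂ)) {G : Measure ℝ}
    (hG : IsMixingLaw ψ G) {σ : ℝ} (hσ : 0 < σ) {j : ℕ} (hj : 1 ≤ j) {a y : ℝ} (hay : a ≤ y) :
    ENNReal.ofReal |(∫ ω, (condCdf μ (modulation X Ξ) Ξ y ω
        - condCdf μ (modulation X Ξ) Ξ a ω) ^ j ∂μ)
        - ∫ v, (normalCdf (σ * v) y - normalCdf (σ * v) a) ^ j ∂G| ≤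
      ∫⁻ ω, min 1 (ENNReal.ofReal (2 * j / σ ^ 2) * ENNReal.ofReal (gramDist X σ j ω))
        ∂(copies μ j) := by
  have := hG.isProbabilityMeasure
  have : IsProbabilityMeasure (copies μ j) := by unfold copies; infer_instance
  have : IsProbabilityMeasure (μ.map Ξ) := Measure.isProbabilityMeasure_map hΞ.aemeasurable
  have : Nonempty (Fin j) := ⟨⟨0, hj⟩⟩
  obtain ⟨e, hmeas⟩ := integral_condCdf_sub_pow hX hΞ h hay j
  simp_rw [e, normalCdf_sub_normalCdf_pow σ _ hay j]
  have hint : Integrable (fun ω => (μ.map Ξ).real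
      {ξ | ∀ i : Fin j, inner ℝ ξ (X (ω i)) ∈ Set.Ioc a y}) (copies μ j) :=
    Integrable.of_bound (C := 1) hmeas.aestronglyMeasurable (.of_forall fun ω => by
      rw [Real.norm_of_nonneg measureReal_nonneg]; exact measureReal_le_one)
  set P := multivariateGaussian 0 (σ ^ 2 • (1 : Matrix (Fin j) (Fin j) ℝ))
  have hbox (Q : Measure (EuclideanSpace ℝ (Fin j))) [IsProbabilityMeasure Q] :
      Integrable (fun v : ℝ => Q.real {w | ∀ i, v * w i ∈ Set.Ioc a y}) G :=
    Integrable.of_bound (C := 1) (measurable_real_scaled_box a y Q).aestronglyMeasurable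
      (.of_forall fun ω => by
        rw [Real.norm_of_nonneg measureReal_nonneg]; exact measureReal_le_one)
  set c := ∫ v, P.real {w | ∀ i, v * w i ∈ Set.Ioc a y} ∂G with hc
  have hsub : (∫ ω, (μ.map Ξ).real {ξ | ∀ i : Fin j, inner ℝ ξ (X (ω i)) ∈ Set.Ioc a y}
      ∂(copies μ j)) - c = ∫ ω, ((μ.map Ξ).real
        {ξ | ∀ i : Fin j, inner ℝ ξ (X (ω i)) ∈ Set.Ioc a y} - c) ∂(copies μ j) := by
    rw [integral_sub hint (integrable_const c)]
    simp
  rw [hsub, ← Real.norm_eq_abs, ofReal_norm]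
  refine (enorm_integral_le_lintegral_enorm _).trans (lintegral_mono fun ω => ?_)
  simp only
  rw [← ofReal_norm, map_real_forall_inner_mem hψ hG (fun i => X (ω i)) a y, hc,
    ← integral_sub (hbox _) (hbox P)]
  set S := Matrix.gram ℝ fun i => X (ω i)
  have hS : S.PosSemidef := Matrix.posSemidef_gram ℝ _
  have bound : ∀ K : ℝ, (∀ v : ℝ,
      |(multivariateGaussian 0 S).real {w | ∀ i, v * w i ∈ Set.Ioc a y} -
        P.real {w | ∀ i, v * w i ∈ Set.Ioc a y}| ≤ K) →
      ‖∫ v, ((multivariateGaussian 0 S).real {w | ∀ i, v * w i ∈ Set.Ioc a y} -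
        P.real {w | ∀ i, v * w i ∈ Set.Ioc a y}) ∂G‖ ≤ K := by
    intro K hK
    have := norm_integral_le_of_norm_le_const (μ := G)
      (f := fun v => (multivariateGaussian 0 S).real {w | ∀ i, v * w i ∈ Set.Ioc a y} -
        P.real {w | ∀ i, v * w i ∈ Set.Ioc a y}) (.of_forall hK)
    simpa using this
  rw [le_min_iff]
  constructor
  · rw [← ENNReal.ofReal_one]
    refine ENNReal.ofReal_le_ofReal (bound 1 fun v => ?_)
    rw [abs_le]
    constructor <;>
    linarith [measureReal_nonneg (μ := P) (s := {w | ∀ i, v * w i ∈ Set.Ioc a y}),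
      measureReal_le_one (μ := P) (s := {w | ∀ i, v * w i ∈ Set.Ioc a y}),
      measureReal_nonneg (μ := multivariateGaussian 0 S) (s := {w | ∀ i, v * w i ∈ Set.Ioc a y}),
      measureReal_le_one (μ := multivariateGaussian 0 S) (s := {w | ∀ i, v * w i ∈ Set.Ioc a y})]
  · rw [← ENNReal.ofReal_mul (by positivity)]
    refine ENNReal.ofReal_le_ofReal (bound _ fun v => ?_)
    have := abs_multivariateGaussian_sub_le_frobenius hS hσ (measurableSet_scaled_box a y v)
    rwa [Fintype.card_fin] at this

lemma lintegral_gramDist_le {m : ℕ} {X : Ω → EuclideanSpace ℝ (Fin m)} (hX : Measurable X)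
    (σ : ℝ) (j : ℕ) :
    ∫⁻ ω, ENNReal.ofReal (gramDist X σ j ω) ∂(copies μ j) ≤
      gramDeviation μ X σ j ^ (1 / 2 : ℝ) := by
  have : IsProbabilityMeasure (copies μ j) := by unfold copies; infer_instance
  -- Cauchy–Schwarz against the constant `1`, valid also when the second moment is infinite.
  have h := ENNReal.lintegral_mul_le_Lp_mul_Lq (copies μ j) Real.HolderConjugate.two_two
    (measurable_gramDist hX σ j).ennreal_ofReal.aemeasurable
    (aemeasurable_const (b := (1 : ℝ≥0∞)))
  rw [gramDeviation_eq]
  simpa [gramDist] using h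

end Bound

/-! ### Convergence in probability of the Gram matrix -/

section Convergence

variable {Ω : Type*} [MeasurableSpace Ω] {μ : Measure Ω} [IsProbabilityMeasure μ]

lemma map_eval_pair_copies {j : ℕ} {i k : Fin j} (hik : i ≠ k) :
    (copies μ j).map (fun ω => (ω i, ω k)) = μ.prod μ := by
  have h := (iIndepFun_pi (μ := fun _ : Fin j => μ) (X := fun _ => id)
    (fun _ => aemeasurable_id)).indepFun hik
  have e (i : Fin j) : (Measure.pi fun _ : Fin j => μ).map (fun ω => ω i) = μ :=
    (measurePreserving_eval (fun _ : Fin j => μ) i).map_eq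
  have h2 := (indepFun_iff_map_prod_eq_prod_map_map (measurable_pi_apply i).aemeasurable
    (measurable_pi_apply k).aemeasurable).1 h
  rwa [e i, e k] at h2

/-- Diagonal entries are governed by the thin shell condition, off-diagonal ones by the overlap of
two independent copies. -/
lemma tendsto_measure_gramCopies_sub {d : ℕ → ℕ} {X : ∀ n, Ω → EuclideanSpace ℝ (Fin (d n))}
    (hX : ∀ n, Measurable (X n)) {σ : ℝ} (h1 : ThinShell μ X σ) (h2 : ZeroOverlap μ X) {j : ℕ}
    (i k : Fin j) {ε : ℝ} (hε : 0 < ε) :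
    Tendsto (fun n => copies μ j {ω | ε ≤
      ‖(gramCopies (X n) j ω - σ ^ 2 • (1 : Matrix (Fin j) (Fin j) ℝ)) i k‖}) atTop (𝓝 0) := by
  by_cases hik : i = k
  · subst hik
    refine (tendstoInMeasure_iff_norm.1 h1 ε hε).congr fun n => ?_
    have hm : MeasurableSet {ω | ε ≤ ‖‖X n ω‖ ^ 2 - σ ^ 2‖} :=
      measurableSet_le measurable_const (by fun_prop)
    rw [← (measurePreserving_eval (fun _ : Fin j => μ) i).measure_preimage hm.nullMeasurableSet]
    unfold copies
    congr 1
    ext ω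
    simp [gramCopies]
  · refine (tendstoInMeasure_iff_norm.1 h2 ε hε).congr fun n => ?_
    have hm : MeasurableSet {p : Ω × Ω | ε ≤ ‖(inner ℝ (X n p.1) (X n p.2) : ℝ) - 0‖} :=
      measurableSet_le measurable_const (by fun_prop)
    rw [← map_eval_pair_copies hik, Measure.map_apply (by fun_prop) hm]
    congr 1
    ext ω
    simp [gramCopies, hik]

lemma tendsto_measure_gramDist {d : ℕ → ℕ} {X : ∀ n, Ω → EuclideanSpace ℝ (Fin (d n))}
    (hX : ∀ n, Measurable (X n)) {σ : ℝ} (h1 : ThinShell μ X σ) (h2 : ZeroOverlap μ X) {j : ℕ}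
    {ε : ℝ} (hε : 0 < ε) :
    Tendsto (fun n => copies μ j {ω | ε < gramDist (X n) σ j ω}) atTop (𝓝 0) := by
  -- If all `j²` entries are below `η`, the Frobenius norm is at most `j η ≤ ε`; the `+ 1` avoids
  -- division by zero at `j = 0`.
  set η := ε / (j + 1) with hη
  have hη0 : 0 < η := by positivity
  have hsum : Tendsto (fun n => ∑ i : Fin j, ∑ k : Fin j, copies μ j {ω | η ≤
      ‖(gramCopies (X n) j ω - σ ^ 2 • (1 : Matrix (Fin j) (Fin j) ℝ)) i k‖}) atTop (𝓝 0) := by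
    have := tendsto_finsetSum (Finset.univ : Finset (Fin j)) fun i _ =>
      tendsto_finsetSum (Finset.univ : Finset (Fin j)) fun k _ =>
        tendsto_measure_gramCopies_sub hX h1 h2 i k hη0
    simpa using this
  refine tendsto_of_tendsto_of_tendsto_of_le_of_le tendsto_const_nhds hsum (fun _ => zero_le)
    fun n => ?_
  have hsub : {ω | ε < gramDist (X n) σ j ω} ⊆ ⋃ i : Fin j, ⋃ k : Fin j, {ω | η ≤
      ‖(gramCopies (X n) j ω - σ ^ 2 • (1 : Matrix (Fin j) (Fin j) ℝ)) i k‖} := by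
    intro ω hω
    by_contra hcon
    simp only [Set.mem_iUnion, Set.mem_ofPred_eq, not_exists, not_le] at hcon
    refine absurd hω (not_lt.2 (Real.sqrt_le_iff.2 ⟨hε.le, ?_⟩))
    calc ∑ i, ∑ k, (gramCopies (X n) j ω - σ ^ 2 • (1 : Matrix (Fin j) (Fin j) ℝ)) i k ^ 2
        ≤ ∑ _i : Fin j, ∑ _k : Fin j, η ^ 2 := by
          refine Finset.sum_le_sum fun i _ => Finset.sum_le_sum fun k _ => ?_
          rw [← sq_abs]
          exact pow_le_pow_left₀ (abs_nonneg _) (hcon i k).le 2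
      _ = (j * η) ^ 2 := by simp; ring
      _ ≤ ε ^ 2 := by
          refine pow_le_pow_left₀ (by positivity) ?_ 2
          rw [hη, mul_div_assoc', div_le_iff₀ (by positivity)]
          nlinarith
  refine (measure_mono hsub).trans ((measure_iUnion_fintype_le _ _).trans
    (Finset.sum_le_sum fun i _ => measure_iUnion_fintype_le _ _))

lemma tendsto_lintegral_min_gramDist {d : ℕ → ℕ} {X : ∀ n, Ω → EuclideanSpace ℝ (Fin (d n))}
    (hX : ∀ n, Measurable (X n)) {σ : ℝ} (h1 : ThinShell μ X σ) (h2 : ZeroOverlap μ X) (j : ℕ)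
    {L : ℝ} (hL : 0 < L) :
    Tendsto (fun n => ∫⁻ ω, min 1 (ENNReal.ofReal L * ENNReal.ofReal (gramDist (X n) σ j ω))
      ∂(copies μ j)) atTop (𝓝 0) := by
  have : IsProbabilityMeasure (copies μ j) := by unfold copies; infer_instance
  rw [ENNReal.tendsto_nhds_zero]
  intro ε hε
  obtain ⟨δ, hδ, hδε⟩ : ∃ δ : ℝ, 0 < δ ∧ ENNReal.ofReal δ ≤ ε / 2 := by
    obtain ⟨δ, h0, hlt⟩ := ENNReal.lt_iff_exists_nnreal_btwn.1 (ENNReal.half_pos hε.ne')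
    exact ⟨δ, by exact_mod_cast h0, by simpa using hlt.le⟩
  filter_upwards [ENNReal.tendsto_nhds_zero.1
    (tendsto_measure_gramDist hX h1 h2 (j := j) (div_pos hδ hL)) (ε / 2)
    (ENNReal.half_pos hε.ne')] with n hn
  have hm : MeasurableSet {ω | δ / L < gramDist (X n) σ j ω} :=
    measurableSet_lt measurable_const (measurable_gramDist (hX n) σ j)
  -- Split at `δ / L`: the truncated distance is at most `δ` below the threshold and at most `1`
  -- above it.
  calc ∫⁻ ω, min 1 (ENNReal.ofReal L * ENNReal.ofReal (gramDist (X n) σ j ω)) ∂(copies μ j)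
      ≤ ∫⁻ ω, (ENNReal.ofReal δ + {ω | δ / L < gramDist (X n) σ j ω}.indicator 1 ω)
          ∂(copies μ j) := by
        refine lintegral_mono fun ω => ?_
        by_cases hω : δ / L < gramDist (X n) σ j ω
        · refine (min_le_left _ _).trans ?_
          have hmem : ω ∈ {ω | δ / L < gramDist (X n) σ j ω} := hω
          rw [Set.indicator_of_mem hmem]
          exact le_add_self
        · refine (min_le_right _ _).trans (le_trans ?_ le_self_add)
          rw [← ENNReal.ofReal_mul hL.le]
          refine ENNReal.ofReal_le_ofReal ?_
          rw [mul_comm, ← le_div_iff₀ hL]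
          exact not_lt.1 hω
    _ = ENNReal.ofReal δ + copies μ j {ω | δ / L < gramDist (X n) σ j ω} := by
        rw [lintegral_add_left measurable_const, lintegral_const, measure_univ, mul_one,
          lintegral_indicator_one hm]
    _ ≤ ε / 2 + ε / 2 := add_le_add hδε hn
    _ = ε := ENNReal.add_halves ε

end Convergence

/-! ### Positivity of the constant and the trade of exponents -/

lemma negMoment_ne_zero {G : Measure ℝ} [IsProbabilityMeasure G] (j : ℕ) : negMoment G j ≠ 0 := by
  unfold negMoment
  rw [Ne, lintegral_eq_zero_iff (by fun_prop)]
  intro h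
  have h2 : ∀ᵐ v ∂G, False := by
    filter_upwards [h] with v hv
    exact pow_ne_zero j (ENNReal.inv_ne_zero.2 ENNReal.ofReal_ne_top) hv
  simp [IsProbabilityMeasure.ne_zero G] at h2

lemma lipConst_ne_zero {σ : ℝ} (hσ : 0 < σ) {G : Measure ℝ} [IsProbabilityMeasure G] {j : ℕ}
    (hj : 1 ≤ j) : lipConst σ G j ≠ 0 := by
  unfold lipConst
  have : (0 : ℝ) < j := by exact_mod_cast hj
  refine mul_ne_zero (ENNReal.ofReal_pos.2 ?_).ne' (negMoment_ne_zero j)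
  have := Real.pi_pos
  positivity

/-- A null sequence bounded by a multiple of `δ^{1/2}` is eventually bounded by any positive
multiple of `δ^{1/4}`. -/
lemma eventually_le_mul_rpow {u v δ : ℕ → ℝ≥0∞} {L C : ℝ≥0∞} (hL0 : L ≠ 0) (hL : L ≠ ∞)
    (hC : C ≠ 0) (huv : ∀ n, u n ≤ v n) (hv : ∀ n, v n ≤ L * δ n ^ (1 / 2 : ℝ))
    (hlim : Tendsto v atTop (𝓝 0)) :
    ∀ᶠ n in atTop, u n ≤ C * δ n ^ (1 / 4 : ℝ) := by
  have hpos : 0 < C * (C / L) :=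
    ENNReal.mul_pos hC (ENNReal.div_pos hC hL).ne'
  filter_upwards [ENNReal.tendsto_nhds_zero.1 hlim _ hpos] with n hn
  refine (huv n).trans ?_
  -- The level `C / L` is where `L δ^{1/2}` and `C δ^{1/4}` cross. The values `δ n = ∞` and `C = ∞`
  -- are covered too.
  rcases le_total (δ n ^ (1 / 4 : ℝ)) (C / L) with h | h
  · refine (hv n).trans ?_
    have e : δ n ^ (1 / 2 : ℝ) = δ n ^ (1 / 4 : ℝ) * δ n ^ (1 / 4 : ℝ) := by
      rw [← ENNReal.rpow_add_of_nonneg _ _ (by norm_num) (by norm_num)]; norm_num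
    rw [e, ← mul_assoc]
    gcongr
    rw [mul_comm]
    exact (ENNReal.le_div_iff_mul_le (.inl hL0) (.inl hL)).1 h
  · exact hn.trans (by gcongr)

/-! ### Assembly for `a < y` -/

section Main

variable {Ω : Type*} [MeasurableSpace Ω] {μ : Measure Ω} [IsProbabilityMeasure μ]

lemma eventually_moment_sub_le {d : ℕ → ℕ} {X Ξ : ∀ n, Ω → EuclideanSpace ℝ (Fin (d n))}
    (hX : ∀ n, Measurable (X n)) (hΞ : ∀ n, Measurable (Ξ n))
    (hindep : ∀ n, IndepFun (X n) (Ξ n) μ) {σ : ℝ} (hσ : 0 < σ)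
    (h1 : ThinShell μ X σ) (h2 : ZeroOverlap μ X) {ψ : ℝ → ℝ}
    (hψ : ∀ n, ∀ u : EuclideanSpace ℝ (Fin (d n)),
      charFun (μ.map (Ξ n)) u = ((ψ (‖u‖ ^ 2) : ℝ) : ℂ))
    {G : Measure ℝ} (hG : IsMixingLaw ψ G) {j : ℕ} (hj : 1 ≤ j) {a y : ℝ} (hay : a < y) :
    ∀ᶠ n in atTop,
      ENNReal.ofReal |(∫ ω, (condCdf μ (modulation (X n) (Ξ n)) (Ξ n) y ω
          - condCdf μ (modulation (X n) (Ξ n)) (Ξ n) a ω) ^ j ∂μ)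
          - ∫ v, (normalCdf (σ * v) y - normalCdf (σ * v) a) ^ j ∂G|
        ≤ lipConst σ G j * ENNReal.ofReal (|y - a| ^ j)
          * (gramDeviation μ (X n) σ j) ^ (1 / 4 : ℝ) := by
  have := hG.isProbabilityMeasure
  have hj' : (0 : ℝ) < j := by exact_mod_cast hj
  have hL : 0 < 2 * (j : ℝ) / σ ^ 2 := by positivity
  have hya : 0 < |y - a| := abs_pos.2 (sub_ne_zero.2 hay.ne')
  refine eventually_le_mul_rpow (L := ENNReal.ofReal (2 * j / σ ^ 2))
    (ENNReal.ofReal_pos.2 hL).ne' ENNReal.ofReal_ne_top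
    (mul_ne_zero (lipConst_ne_zero hσ hj) (ENNReal.ofReal_pos.2 (by positivity)).ne')
    (fun n => ofReal_abs_moment_sub_le (hX n) (hΞ n) (hindep n) (hψ n) hG hσ hj hay.le)
    (fun n => ?_) (tendsto_lintegral_min_gramDist hX h1 h2 j hL)
  calc ∫⁻ ω, min 1 (ENNReal.ofReal (2 * j / σ ^ 2) * ENNReal.ofReal (gramDist (X n) σ j ω))
        ∂(copies μ j)
      ≤ ∫⁻ ω, ENNReal.ofReal (2 * j / σ ^ 2) * ENNReal.ofReal (gramDist (X n) σ j ω)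
        ∂(copies μ j) := lintegral_mono fun ω => min_le_right _ _
    _ = ENNReal.ofReal (2 * j / σ ^ 2) *
        ∫⁻ ω, ENNReal.ofReal (gramDist (X n) σ j ω) ∂(copies μ j) :=
        lintegral_const_mul _ (measurable_gramDist (hX n) σ j).ennreal_ofReal
    _ ≤ _ := by gcongr; exact lintegral_gramDist_le (hX n) σ j

end Main

end RandomModulation

theorem mainTheorem6 {Ω : Type*} [MeasurableSpace Ω] (μ : Measure Ω) [IsProbabilityMeasure μ]
    (d : ℕ → ℕ) (hd_pos : ∀ n, 0 < d n) (hd_mono : Monotone d) (hd_top : Tendsto d atTop atTop)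
    (X Ξ : ∀ n, Ω → EuclideanSpace ℝ (Fin (d n)))
    (hX : ∀ n, Measurable (X n)) (hΞ : ∀ n, Measurable (Ξ n))
    -- each `X n` is a continuous random vector
    (hXac : ∀ n, μ.map (X n) ≪ volume)
    (hindep : ∀ n, IndepFun (X n) (Ξ n) μ)
    (σ : ℝ) (hσ : 0 < σ) (k : ℕ)
    (hC1 : RandomModulation.ThinShell μ X σ)
    (hC2 : RandomModulation.ZeroOverlap μ X)
    (hC3 : RandomModulation.GramDetMoment μ X k)
    (hcf : ∀ n, RandomModulation.IntegrableCF μ (X n))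
    (ψ : ℝ → ℝ)
    (hψ : ∀ n, ∀ u : EuclideanSpace ℝ (Fin (d n)),
      charFun (μ.map (Ξ n)) u = ((ψ (‖u‖ ^ 2) : ℝ) : ℂ))
    (G : Measure ℝ) (hG : RandomModulation.IsMixingLaw ψ G)
    (hGk : RandomModulation.negMoment G k < ∞)
    (j : ℕ) (hj : 1 ≤ j) (hjk : j ≤ k) (y a : ℝ) :
    ∃ n_j : ℕ, ∀ n, n_j ≤ n →
      ENNReal.ofReal
        |(∫ ω, (RandomModulation.condCdf μ (RandomModulation.modulation (X n) (Ξ n)) (Ξ n) y ω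
            - RandomModulation.condCdf μ (RandomModulation.modulation (X n) (Ξ n)) (Ξ n) a ω) ^ j
            ∂μ)
          - ∫ v, (RandomModulation.normalCdf (σ * v) y
            - RandomModulation.normalCdf (σ * v) a) ^ j ∂G|
      ≤ RandomModulation.lipConst σ G j * ENNReal.ofReal (|y - a| ^ j)
          * (RandomModulation.gramDeviation μ (X n) σ j) ^ (1 / 4 : ℝ) := by
  rcases lt_trichotomy a y with hay | rfl | hay
  · exact eventually_atTop.1
      (RandomModulation.eventually_moment_sub_le hX hΞ hindep hσ hC1 hC2 hψ hG hj hay)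
  -- For `y = a` both moments vanish, since `0 ^ j = 0` for `j ≥ 1`.
  · exact ⟨0, fun n _ => by simp [Nat.one_le_iff_ne_zero.1 hj]⟩
  · obtain ⟨N, hN⟩ := eventually_atTop.1
      (RandomModulation.eventually_moment_sub_le hX hΞ hindep hσ hC1 hC2 hψ hG hj hay)
    refine ⟨N, fun n hn => ?_⟩
    have h := hN n hn
    -- Exchanging `a` and `y` multiplies both moments by `(-1) ^ j`, which the absolute value
    -- removes.
    have hflip : ∀ s t : ℝ, (s - t) ^ j = (-1) ^ j * (t - s) ^ j := fun s t => by
      rw [← mul_pow]; ring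
    simp_rw [hflip (RandomModulation.condCdf μ _ _ y _), hflip (RandomModulation.normalCdf _ y),
      integral_const_mul]
    rwa [← mul_sub, abs_mul, abs_pow, abs_neg, abs_one, one_pow, one_mul, abs_sub_comm y a]
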